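/- For $n\ge 0$ let $Q_n$ be the $n$-cube: its vertices are the subsets of $[n]=\{1,\dots,n\}$, and $X,Y$ are joined by an edge, of direction $i$, if $X\oplus Y=\{i\}$ (symmetric difference). The signature $\mathrm{sig}(T)=(a_1,\dots,a_n)$ of a spanning tree $T$ of $Q_n$ records the number $a_i$ of edges of $T$ in direction $i$; let $\mathrm{Sig}(Q_n)$ be the set of signatures of spanning trees of $Q_n$. Write $\sigma_i(X)=X\oplus\{i\}$. An edge slide replaces an edge $e$ of $T$ in a direction $j\ne i$ by the edge $\sigma_i(e)\notin T$, provided that $T-e+\sigma_i(e)$ is again a spanning tree. The edge slide graph $\mathcal{E}(Q_n)$ has the spanning trees of $Q_n$ as vertices, two trees being adjacent if they are related by a single edge slide; $\mathcal{E}(\mathcal{S})$ is its subgraph induced by the trees with signature $\mathcal{S}$, and $\mathcal{E}(\mathcal{X})=\bigcup_{\mathcal{S}\in\mathcal{X}}\mathcal{E}(\mathcal{S})$ for a set $\mathcal{X}$ of signatures. A signature $\mathcal{S}=(a_1,\dots,a_n)$ of $Q_n$ reduces over a proper nonempty subset $R\subset[n]$ if $\sum_{i\in R}a_i=2^{|R|}-1$,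 and $\mathrm{Red}_n(R)$ is the set of signatures of $Q_n$ that reduce over $R$. Write $\square$ for the Cartesian product and $\coprod$ for the disjoint union of graphs. **Theorem.** Let $n\geq 2$. Then $$\mathcal{E}(\mathrm{Red}_n(\{1\}))\;\cong\; Q_{n-1}\,\square\,\mathcal{E}(Q_{n-1})\,\square\,\mathcal{E}(Q_{n-1})\;\cong\;\coprod_{\mathcal{S}_1,\mathcal{S}_2\in \mathrm{Sig}(Q_{n-1})}Q_{n-1}\,\square\,\mathcal{E}(\mathcal{S}_1)\,\square\,\mathcal{E}(\mathcal{S}_2).$$ Moreover, for every $\mathcal{S}=(1,\mathcal{S}')\in\mathrm{Red}_n(\{1\})$, $$\mathcal{E}(\mathcal{S})\;\cong\;\coprod_{\substack{\mathcal{S}_1,\mathcal{S}_2\in \mathrm{Sig}(Q_{n-1})\\ \mathcal{S}_1+\mathcal{S}_2=\mathcal{S}'}}Q_{n-1}\,\square\,\mathcal{E}(\mathcal{S}_1)\,\square\,\mathcal{E}(\mathcal{S}_2).$$ -/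

import Mathlib

/-- The `n`-cube `Q_n`: its vertices are the subsets of `[n]` (modelled by `Fin n`, so that
direction `1` is `0 : Fin n`), and two vertices are adjacent when they differ by adding or
removing exactly one element. -/
def cube (n : ℕ) : SimpleGraph (Finset (Fin n)) where
  Adj X Y := ∃ i : Fin n, symmDiff X Y = {i}
  symm := ⟨fun X Y ⟨i, hi⟩ => ⟨i, by rw [symmDiff_comm]; exact hi⟩⟩
  loopless := ⟨fun X ⟨i, hi⟩ => by simp at hi⟩

/-- The edge `e = {X, Y}` has direction `i`, i.e. `X ⊕ Y = {i}`. -/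
def HasDirection {n : ℕ} (e : Sym2 (Finset (Fin n))) (i : Fin n) : Prop :=
  ∃ X Y : Finset (Fin n), e = s(X, Y) ∧ symmDiff X Y = {i}

/-- The spanning trees of `Q_n`, as subgraphs of `Q_n` containing all the vertices. -/
def SpanningTree (n : ℕ) : Type :=
  {T : SimpleGraph (Finset (Fin n)) // T ≤ cube n ∧ T.IsTree}

/-- The edge set of a spanning tree. -/
def SpanningTree.edges {n : ℕ} (T : SpanningTree n) : Set (Sym2 (Finset (Fin n))) :=
  T.1.edgeSet

/-- The signature of a spanning tree: entry `i` is the number of its edges in direction `i`. -/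
noncomputable def SpanningTree.sig {n : ℕ} (T : SpanningTree n) : Fin n → ℕ :=
  fun i => {e | e ∈ T.edges ∧ HasDirection e i}.ncard

/-- `Sig(Q_n)`, the set of signatures of spanning trees of `Q_n`. -/
def signatures (n : ℕ) : Set (Fin n → ℕ) :=
  Set.range (SpanningTree.sig (n := n))

/-- The map `σ_i(X) = X ⊕ {i}` on the vertices of `Q_n`. -/
def flipVertex {n : ℕ} (i : Fin n) (X : Finset (Fin n)) : Finset (Fin n) :=
  symmDiff X {i}

/-- The map induced by `σ_i` on edges. -/
def flipEdge {n : ℕ} (i : Fin n) (e : Sym2 (Finset (Fin n))) : Sym2 (Finset (Fin n)) :=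
  e.map (flipVertex i)

/-- `T'` is obtained from `T` by sliding the edge `e` in direction `i`: `e` is an edge of `T` in a
direction `j ≠ i`, the edge `σ_i(e)` is not in `T`, and `T' = T - e + σ_i(e)`. -/
def IsSlide {n : ℕ} (i : Fin n) (e : Sym2 (Finset (Fin n))) (T T' : SpanningTree n) : Prop :=
  (∃ j : Fin n, j ≠ i ∧ HasDirection e j) ∧ e ∈ T.edges ∧ flipEdge i e ∉ T.edges ∧
    T'.edges = insert (flipEdge i e) (T.edges \ {e})

theorem flipVertex_flipVertex {n : ℕ} (i : Fin n) (X : Finset (Fin n)) :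
    flipVertex i (flipVertex i X) = X := by
  simp [flipVertex]

theorem flipEdge_flipEdge {n : ℕ} (i : Fin n) (e : Sym2 (Finset (Fin n))) :
    flipEdge i (flipEdge i e) = e := by
  induction e with
  | _ X Y => simp [flipEdge, flipVertex_flipVertex]

theorem HasDirection.flipEdge {n : ℕ} {e : Sym2 (Finset (Fin n))} {j : Fin n}
    (h : HasDirection e j) (i : Fin n) : HasDirection (flipEdge i e) j := by
  obtain ⟨X, Y, rfl, hXY⟩ := h
  refine ⟨flipVertex i X, flipVertex i Y, rfl, ?_⟩
  rw [flipVertex, flipVertex, symmDiff_symmDiff_symmDiff_comm, symmDiff_self, symmDiff_bot, hXY]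

theorem IsSlide.symm {n : ℕ} {i : Fin n} {e : Sym2 (Finset (Fin n))} {T T' : SpanningTree n}
    (h : IsSlide i e T T') : IsSlide i (flipEdge i e) T' T := by
  obtain ⟨⟨j, hj, hd⟩, he, hf, hT⟩ := h
  have hne : e ≠ flipEdge i e := fun h => hf (h ▸ he)
  refine ⟨⟨j, hj, hd.flipEdge i⟩, ?_, ?_, ?_⟩
  · rw [hT]; exact Set.mem_insert _ _
  · rw [flipEdge_flipEdge, hT]
    simp [hne]
  · rw [flipEdge_flipEdge, hT]
    ext x
    simp only [Set.mem_insert_iff, Set.mem_sdiff, Set.mem_singleton_iff]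
    constructor
    · intro hx
      by_cases hxe : x = e
      · exact Or.inl hxe
      · exact Or.inr ⟨Or.inr ⟨hx, hxe⟩, fun h => hf (h ▸ hx)⟩
    · rintro (rfl | ⟨rfl | ⟨hx, _⟩, h2⟩)
      · exact he
      · exact absurd rfl h2
      · exact hx

/-- The edge slide graph `E(Q_n)`: its vertices are the spanning trees of `Q_n`, and two trees are
adjacent when they are related by a single edge slide. -/
def edgeSlideGraph (n : ℕ) : SimpleGraph (SpanningTree n) where
  Adj T T' := ∃ i e, IsSlide i e T T'
  symm := ⟨fun _ _ ⟨i, e, h⟩ => ⟨i, flipEdge i e, h.symm⟩⟩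
  loopless := ⟨fun _ ⟨_, _, _, _, hf, hT⟩ => hf (hT ▸ Set.mem_insert _ _)⟩

/-- The edge slide graph `E(S)` of `S`: the subgraph of `E(Q_n)` induced by the spanning trees
with signature `S`. -/
def edgeSlideSig {n : ℕ} (S : Fin n → ℕ) : (edgeSlideGraph n).Subgraph :=
  (⊤ : (edgeSlideGraph n).Subgraph).induce {T | T.sig = S}

/-- `E(𝒳) = ⋃_{S ∈ 𝒳} E(S)` for a set `𝒳` of signatures. -/
def edgeSlideSet {n : ℕ} (𝒳 : Set (Fin n → ℕ)) : (edgeSlideGraph n).Subgraph :=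
  ⨆ S ∈ 𝒳, edgeSlideSig S

/-- `S` reduces over `R`: the set `R` is a proper nonempty subset of `[n]` and
`∑_{i ∈ R} a_i = 2^|R| - 1`. -/
def ReducesOver {n : ℕ} (S : Fin n → ℕ) (R : Finset (Fin n)) : Prop :=
  R.Nonempty ∧ R ≠ Finset.univ ∧ ∑ i ∈ R, S i = 2 ^ R.card - 1

/-- The set `Red_n(R)` of signatures of `Q_n` that reduce over `R`. -/
def reducing {n : ℕ} (R : Finset (Fin n)) : Set (Fin n → ℕ) :=
  {S | S ∈ signatures n ∧ ReducesOver S R}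

/-- The disjoint union of a family of graphs. -/
def disjointUnion {ι : Type*} {V : ι → Type*} (G : ∀ i, SimpleGraph (V i)) :
    SimpleGraph (Σ i, V i) where
  Adj x y := ∃ (i : ι) (u v : V i), (G i).Adj u v ∧ x = ⟨i, u⟩ ∧ y = ⟨i, v⟩
  symm := ⟨fun _ _ ⟨i, u, v, h, hx, hy⟩ => ⟨i, v, u, h.symm, hy, hx⟩⟩
  loopless := ⟨by
    rintro _ ⟨i, u, v, h, rfl, hy⟩
    obtain rfl : u = v := by simpa using hy
    exact (G i).loopless.irrefl u h⟩

/-! Reducing over a single direction means containing exactly one edge of that direction, since `2 ^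
1 - 1 = 1`. Deleting direction `0` splits `Q_{m+1}` into two copies of `Q_m`. A spanning tree with
only one edge across meets each copy in a spanning tree, and conversely any two spanning trees of
the copies, joined by any one cross edge, form a spanning tree. Such trees therefore correspond to
triples of a vertex `X` of `Q_m`, marking the position of the bridge, and two spanning trees of
`Q_m` (`sig_zero_eq_one_iff`, `glue_injective`).

An edge slide changes exactly one coordinate of the triple (`edgeSlideGraph_adj_glue`). Sliding the
bridge moves `X` to a neighbour in the cube, and any neighbour can be reached. Sliding an edge
within its face is an edge slide of that face's tree. Sliding a face edge across direction `0` is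
impossible, because one face would be left with too many edges. This is adjacency in the box
product.

The disjoint unions follow because edge slides preserve signatures (`IsSlide.sig_eq`), so the box
product splits according to the signatures of the two trees. The signature of a glued tree is `1`
followed by the sum of these two signatures (`sig_glue`), which selects the pieces lying over a
given `S'`. -/

/-! ### Vertices of the cube, split along direction `0` -/

/-- The vertices of `Q_{m+1}` in the face of direction `0` selected by `b`: the set `Y` shifted up
by one, together with `0` when `b` is true. -/
def face {m : ℕ} (b : Bool) (Y : Finset (Fin m)) : Finset (Fin (m + 1)) :=
  if b then insert 0 (Y.map (Fin.succEmb m)) else Y.map (Fin.succEmb m)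

@[simp] theorem zero_mem_face {m : ℕ} {b : Bool} {Y : Finset (Fin m)} :
    0 ∈ face b Y ↔ b = true := by
  cases b <;> simp [face, Fin.succ_ne_zero]

@[simp] theorem succ_mem_face {m : ℕ} {b : Bool} {Y : Finset (Fin m)} {i : Fin m} :
    i.succ ∈ face b Y ↔ i ∈ Y := by
  cases b <;> simp [face, Fin.succ_ne_zero]

theorem finset_fin_succ_ext {m : ℕ} {Z W : Finset (Fin (m + 1))} (h0 : 0 ∈ Z ↔ 0 ∈ W)
    (hs : ∀ i : Fin m, i.succ ∈ Z ↔ i.succ ∈ W) : Z = W := by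
  ext i
  cases i using Fin.cases with
  | zero => exact h0
  | succ i => exact hs i

@[simp] theorem face_inj {m : ℕ} {b c : Bool} {Y Z : Finset (Fin m)} :
    face b Y = face c Z ↔ b = c ∧ Y = Z := by
  constructor
  · intro h
    have h0 : 0 ∈ face b Y ↔ 0 ∈ face c Z := by rw [h]
    rw [zero_mem_face, zero_mem_face] at h0
    refine ⟨Bool.eq_iff_iff.2 h0, ?_⟩
    ext i
    rw [← succ_mem_face (b := b), h, succ_mem_face]
  · rintro ⟨rfl, rfl⟩
    rfl

theorem face_injective {m : ℕ} (b : Bool) : Function.Injective (face (m := m) b) :=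
  fun _ _ h => (face_inj.1 h).2

/-- The projection of `Q_{m+1}` onto `Q_m` along direction `0`. -/
def lowerVertex {m : ℕ} (Z : Finset (Fin (m + 1))) : Finset (Fin m) :=
  Finset.univ.filter fun i => i.succ ∈ Z

@[simp] theorem lowerVertex_face {m : ℕ} (b : Bool) (Y : Finset (Fin m)) :
    lowerVertex (face b Y) = Y := by
  ext i
  simp [lowerVertex]

theorem exists_eq_face {m : ℕ} (Z : Finset (Fin (m + 1))) :
    ∃ b Y, Z = face b Y :=
  ⟨decide (0 ∈ Z), lowerVertex Z, finset_fin_succ_ext (by simp) (by simp [lowerVertex])⟩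

theorem symmDiff_face_face {m : ℕ} (b : Bool) (Y Z : Finset (Fin m)) :
    symmDiff (face b Y) (face b Z) = face false (symmDiff Y Z) :=
  finset_fin_succ_ext (by simp [Finset.mem_symmDiff]) (by simp [Finset.mem_symmDiff])

theorem symmDiff_face_not {m : ℕ} (b : Bool) (Y Z : Finset (Fin m)) :
    symmDiff (face b Y) (face (!b) Z) = face true (symmDiff Y Z) :=
  finset_fin_succ_ext (by cases b <;> simp [Finset.mem_symmDiff])
    (by simp [Finset.mem_symmDiff])

theorem face_true_empty {m : ℕ} : face true (∅ : Finset (Fin m)) = {0} := by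
  simp [face]

theorem face_false_singleton {m : ℕ} (i : Fin m) : face false {i} = {i.succ} := by
  simp [face]

theorem flipVertex_succ_face {m : ℕ} (i : Fin m) (b : Bool) (Y : Finset (Fin m)) :
    flipVertex i.succ (face b Y) = face b (flipVertex i Y) :=
  finset_fin_succ_ext
    (by simp [flipVertex, Finset.mem_symmDiff, (Fin.succ_ne_zero i).symm])
    (by simp [flipVertex, Finset.mem_symmDiff])

theorem flipVertex_zero_face {m : ℕ} (b : Bool) (Y : Finset (Fin m)) :
    flipVertex 0 (face b Y) = face (!b) Y :=
  finset_fin_succ_ext (by cases b <;> simp [flipVertex, Finset.mem_symmDiff])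
    (by simp [flipVertex, Finset.mem_symmDiff, Fin.succ_ne_zero])

/-! ### Edges of the cube: face edges and cross edges -/

/-- The copy of an edge of `Q_m` in the face of `Q_{m+1}` selected by `b`. -/
def faceEdge {m : ℕ} (b : Bool) (e : Sym2 (Finset (Fin m))) : Sym2 (Finset (Fin (m + 1))) :=
  e.map (face b)

/-- The edge of direction `0` of `Q_{m+1}` above the vertex `Y` of `Q_m`. -/
def crossEdge {m : ℕ} (Y : Finset (Fin m)) : Sym2 (Finset (Fin (m + 1))) :=
  s(face false Y, face true Y)

theorem faceEdge_injective {m : ℕ} (b : Bool) : Function.Injective (faceEdge (m := m) b) :=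
  Sym2.map.injective (face_injective b)

@[simp] theorem faceEdge_inj {m : ℕ} {b c : Bool} {e f : Sym2 (Finset (Fin m))} :
    faceEdge b e = faceEdge c f ↔ b = c ∧ e = f := by
  refine ⟨fun h => ?_, by rintro ⟨rfl, rfl⟩; rfl⟩
  obtain rfl : b = c := by
    induction e with
    | _ X Y =>
      induction f with
      | _ Z W =>
        simp only [faceEdge, Sym2.map_mk, Sym2.eq_iff, face_inj] at h
        tauto
  exact ⟨rfl, faceEdge_injective b h⟩

@[simp] theorem crossEdge_inj {m : ℕ} {Y Z : Finset (Fin m)} :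
    crossEdge Y = crossEdge Z ↔ Y = Z := by
  simp [crossEdge]

@[simp] theorem faceEdge_ne_crossEdge {m : ℕ} (b : Bool) (e : Sym2 (Finset (Fin m)))
    (Y : Finset (Fin m)) : faceEdge b e ≠ crossEdge Y := by
  induction e with
  | _ X Z => cases b <;> simp [faceEdge, crossEdge]

@[simp] theorem crossEdge_ne_faceEdge {m : ℕ} (b : Bool) (e : Sym2 (Finset (Fin m)))
    (Y : Finset (Fin m)) : crossEdge Y ≠ faceEdge b e :=
  (faceEdge_ne_crossEdge b e Y).symm

theorem hasDirection_mk {n : ℕ} {X Y : Finset (Fin n)} {i : Fin n} :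
    HasDirection s(X, Y) i ↔ symmDiff X Y = {i} := by
  refine ⟨?_, fun h => ⟨X, Y, rfl, h⟩⟩
  rintro ⟨Z, W, h, hZW⟩
  rcases Sym2.eq_iff.1 h with ⟨rfl, rfl⟩ | ⟨rfl, rfl⟩
  · exact hZW
  · rwa [symmDiff_comm]

theorem hasDirection_faceEdge {m : ℕ} {b : Bool} {e : Sym2 (Finset (Fin m))} {i : Fin m} :
    HasDirection (faceEdge b e) i.succ ↔ HasDirection e i := by
  induction e with
  | _ X Y =>
    rw [faceEdge, Sym2.map_mk, hasDirection_mk, hasDirection_mk, symmDiff_face_face,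
      ← face_false_singleton, face_inj]
    simp

theorem not_hasDirection_zero_faceEdge {m : ℕ} {b : Bool} {e : Sym2 (Finset (Fin m))} :
    ¬ HasDirection (faceEdge b e) 0 := by
  induction e with
  | _ X Y =>
    rw [faceEdge, Sym2.map_mk, hasDirection_mk, symmDiff_face_face, ← face_true_empty, face_inj]
    simp

theorem hasDirection_crossEdge {m : ℕ} {Y : Finset (Fin m)} {i : Fin (m + 1)} :
    HasDirection (crossEdge Y) i ↔ i = 0 := by
  have h := symmDiff_face_not false Y Y
  rw [symmDiff_self, Finset.bot_eq_empty, face_true_empty] at h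
  rw [crossEdge, hasDirection_mk, ← Bool.not_false, h, Finset.singleton_inj, eq_comm]

theorem flipEdge_succ_faceEdge {m : ℕ} (i : Fin m) (b : Bool) (e : Sym2 (Finset (Fin m))) :
    flipEdge i.succ (faceEdge b e) = faceEdge b (flipEdge i e) := by
  induction e with
  | _ X Y => simp [flipEdge, faceEdge, flipVertex_succ_face]

theorem flipEdge_zero_faceEdge {m : ℕ} (b : Bool) (e : Sym2 (Finset (Fin m))) :
    flipEdge 0 (faceEdge b e) = faceEdge (!b) e := by
  induction e with
  | _ X Y => simp [flipEdge, faceEdge, flipVertex_zero_face]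

theorem flipEdge_succ_crossEdge {m : ℕ} (i : Fin m) (Y : Finset (Fin m)) :
    flipEdge i.succ (crossEdge Y) = crossEdge (flipVertex i Y) := by
  simp [flipEdge, crossEdge, flipVertex_succ_face]

/-- The endpoints differ in a single coordinate: if it is not `0` they share a face, and if it is
`0` they have the same projection to `Q_m`. -/
theorem exists_faceEdge_or_crossEdge {m : ℕ} {e : Sym2 (Finset (Fin (m + 1)))}
    (he : e ∈ (cube (m + 1)).edgeSet) : (∃ b f, e = faceEdge b f) ∨ ∃ Y, e = crossEdge Y := by
  induction e with
  | _ Z W =>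
    obtain ⟨i, hi⟩ : ∃ i, symmDiff Z W = {i} := he
    obtain ⟨b, Y, rfl⟩ := exists_eq_face Z
    obtain ⟨c, V, rfl⟩ := exists_eq_face W
    by_cases hbc : c = b
    · subst hbc
      exact Or.inl ⟨c, s(Y, V), rfl⟩
    · obtain rfl : c = !b := Bool.eq_not.2 hbc
      rw [symmDiff_face_not] at hi
      have hi0 : i = 0 := by
        have : (0 : Fin (m + 1)) ∈ face true (symmDiff Y V) := by simp
        rw [hi] at this
        simpa [eq_comm] using this
      rw [hi0, ← face_true_empty, face_inj] at hi
      obtain rfl : Y = V := symmDiff_eq_bot.1 hi.2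
      refine Or.inr ⟨Y, ?_⟩
      cases b
      · rfl
      · exact Sym2.eq_swap

theorem cube_adj_face {m : ℕ} {b : Bool} {Y Z : Finset (Fin m)} :
    (cube (m + 1)).Adj (face b Y) (face b Z) ↔ (cube m).Adj Y Z := by
  constructor
  · rintro ⟨i, hi⟩
    rw [symmDiff_face_face] at hi
    cases i using Fin.cases with
    | zero => simp [← face_true_empty] at hi
    | succ i => exact ⟨i, (face_inj.1 (hi.trans (face_false_singleton i).symm)).2⟩
  · rintro ⟨i, hi⟩
    exact ⟨i.succ, by rw [symmDiff_face_face, hi, face_false_singleton]⟩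

theorem cube_adj_face_not {m : ℕ} (b : Bool) (Y : Finset (Fin m)) :
    (cube (m + 1)).Adj (face b Y) (face (!b) Y) :=
  ⟨0, by rw [symmDiff_face_not, symmDiff_self, Finset.bot_eq_empty, face_true_empty]⟩

/-! ### Gluing two spanning trees along a bridge -/

/-- The graph on the vertices of `Q_{m+1}` which restricts to `T b` on the face selected by `b`,
and in which the two faces are joined by the single edge of direction `0` above `X`. -/
def glueGraph {m : ℕ} (X : Finset (Fin m)) (T : Bool → SimpleGraph (Finset (Fin m))) :
    SimpleGraph (Finset (Fin (m + 1))) :=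
  SimpleGraph.fromEdgeSet
    ((faceEdge false '' (T false).edgeSet ∪ faceEdge true '' (T true).edgeSet) ∪ {crossEdge X})

theorem edgeSet_glueGraph {m : ℕ} (X : Finset (Fin m))
    (T : Bool → SimpleGraph (Finset (Fin m))) :
    (glueGraph X T).edgeSet =
      (faceEdge false '' (T false).edgeSet ∪ faceEdge true '' (T true).edgeSet) ∪
        {crossEdge X} := by
  -- `fromEdgeSet` discards loops, so the listed edges must be shown not to be diagonal.
  have key : ∀ b (e : Sym2 (Finset (Fin m))), e ∈ (T b).edgeSet → ¬ (faceEdge b e).IsDiag := by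
    intro b e he
    induction e with
    | _ Y Z =>
      have hne : Y ≠ Z := SimpleGraph.Adj.ne he
      simpa [faceEdge] using hne
  rw [glueGraph, SimpleGraph.edgeSet_fromEdgeSet, sdiff_eq_left, Set.disjoint_left]
  rintro e ((⟨f, hf, rfl⟩ | ⟨f, hf, rfl⟩) | rfl)
  · exact key _ _ hf
  · exact key _ _ hf
  · simp [crossEdge]

theorem faceEdge_mem_edgeSet_glueGraph {m : ℕ} {X : Finset (Fin m)}
    {T : Bool → SimpleGraph (Finset (Fin m))} {b : Bool} {e : Sym2 (Finset (Fin m))} :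
    faceEdge b e ∈ (glueGraph X T).edgeSet ↔ e ∈ (T b).edgeSet := by
  rw [edgeSet_glueGraph]
  cases b <;> simp

theorem crossEdge_mem_edgeSet_glueGraph {m : ℕ} {X Y : Finset (Fin m)}
    {T : Bool → SimpleGraph (Finset (Fin m))} :
    crossEdge Y ∈ (glueGraph X T).edgeSet ↔ Y = X := by
  rw [edgeSet_glueGraph]
  simp

theorem glueGraph_adj_face {m : ℕ} {X : Finset (Fin m)}
    {T : Bool → SimpleGraph (Finset (Fin m))} {b : Bool} {Y Z : Finset (Fin m)} :
    (glueGraph X T).Adj (face b Y) (face b Z) ↔ (T b).Adj Y Z :=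
  faceEdge_mem_edgeSet_glueGraph (e := s(Y, Z))

theorem glueGraph_le_cube {m : ℕ} {X : Finset (Fin m)}
    {T : Bool → SimpleGraph (Finset (Fin m))} (hT : ∀ b, T b ≤ cube m) :
    glueGraph X T ≤ cube (m + 1) := by
  rw [← SimpleGraph.edgeSet_subset_edgeSet, edgeSet_glueGraph]
  have key : ∀ b (e : Sym2 (Finset (Fin m))), e ∈ (T b).edgeSet →
      faceEdge b e ∈ (cube (m + 1)).edgeSet := by
    intro b e he
    induction e with
    | _ Y Z => exact cube_adj_face.2 (hT b he)
  rintro e ((⟨f, hf, rfl⟩ | ⟨f, hf, rfl⟩) | rfl)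
  · exact key _ _ hf
  · exact key _ _ hf
  · exact cube_adj_face_not false X

/-- Within its face every vertex reaches the end of the bridge above `X`, and the bridge joins the
two ends. -/
theorem connected_glueGraph {m : ℕ} {X : Finset (Fin m)}
    {T : Bool → SimpleGraph (Finset (Fin m))} (hT : ∀ b, (T b).Connected) :
    (glueGraph X T).Connected := by
  have hface : ∀ b Y, (glueGraph X T).Reachable (face b Y) (face b X) := fun b Y =>
    ((hT b).preconnected Y X).map ⟨face b, fun h => glueGraph_adj_face.2 h⟩
  have hcross : (glueGraph X T).Adj (face false X) (face true X) :=
    crossEdge_mem_edgeSet_glueGraph.2 rfl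
  have hroot : ∀ Z, (glueGraph X T).Reachable Z (face false X) := by
    intro Z
    obtain ⟨b, Y, rfl⟩ := exists_eq_face Z
    cases b
    · exact hface _ _
    · exact (hface _ _).trans hcross.symm.reachable
  exact ⟨fun Z W => (hroot Z).trans (hroot W).symm⟩

/-- A connected graph is a tree when it has one edge fewer than vertices; here `(2 ^ m - 1) + (2 ^ m
- 1) + 1 = 2 ^ (m + 1) - 1`. -/
theorem isTree_glueGraph {m : ℕ} {X : Finset (Fin m)}
    {T : Bool → SimpleGraph (Finset (Fin m))} (hT : ∀ b, (T b).IsTree) :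
    (glueGraph X T).IsTree := by
  have hcard : ∀ b, (T b).edgeSet.ncard + 1 = 2 ^ m := fun b => by
    have := (SimpleGraph.isTree_iff_connected_and_card.1 (hT b)).2
    simpa [Nat.card_eq_fintype_card] using this
  refine SimpleGraph.isTree_iff_connected_and_card.2
    ⟨connected_glueGraph fun b => (hT b).connected, ?_⟩
  rw [Nat.card_coe_set_eq, edgeSet_glueGraph, Set.ncard_union_eq, Set.ncard_union_eq,
    Set.ncard_image_of_injective _ (faceEdge_injective _),
    Set.ncard_image_of_injective _ (faceEdge_injective _), Set.ncard_singleton]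
  · have h0 := hcard false
    have h1 := hcard true
    simp only [Nat.card_eq_fintype_card, Fintype.card_finset, Fintype.card_fin, pow_succ]
    omega
  · rw [Set.disjoint_left]
    rintro _ ⟨e, _, rfl⟩ ⟨f, _, h⟩
    simp at h
  · rw [Set.disjoint_singleton_right]
    simp

/-- The spanning tree of `Q_{m+1}` made of the spanning trees `T b` of the two faces of direction
`0`, joined by the edge of direction `0` above `X`. -/
def glue {m : ℕ} (X : Finset (Fin m)) (T : Bool → SpanningTree m) : SpanningTree (m + 1) :=
  ⟨glueGraph X fun b => (T b).1, glueGraph_le_cube fun b => (T b).2.1,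
    isTree_glueGraph fun b => (T b).2.2⟩

theorem faceEdge_mem_glue {m : ℕ} {X : Finset (Fin m)} {T : Bool → SpanningTree m} {b : Bool}
    {e : Sym2 (Finset (Fin m))} : faceEdge b e ∈ (glue X T).edges ↔ e ∈ (T b).edges :=
  faceEdge_mem_edgeSet_glueGraph (T := fun b => (T b).1)

theorem crossEdge_mem_glue {m : ℕ} {X Y : Finset (Fin m)} {T : Bool → SpanningTree m} :
    crossEdge Y ∈ (glue X T).edges ↔ Y = X :=
  crossEdge_mem_edgeSet_glueGraph (T := fun b => (T b).1)

theorem SpanningTree.ext_edges {n : ℕ} {T T' : SpanningTree n} (h : T.edges = T'.edges) :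
    T = T' :=
  Subtype.ext (SimpleGraph.edgeSet_injective h)

theorem SpanningTree.edges_subset {n : ℕ} (T : SpanningTree n) : T.edges ⊆ (cube n).edgeSet :=
  SimpleGraph.edgeSet_subset_edgeSet.2 T.2.1

/-- A tree is a minimal connected graph, so no spanning tree properly contains another. -/
theorem SpanningTree.eq_of_subset {n : ℕ} {T T' : SpanningTree n} (h : T.edges ⊆ T'.edges) :
    T = T' :=
  Subtype.ext <| le_antisymm (SimpleGraph.edgeSet_subset_edgeSet.1 h) <|
    (SimpleGraph.isTree_iff_minimal_connected.1 T'.2.2).2 T.2.2.connected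
      (SimpleGraph.edgeSet_subset_edgeSet.1 h)

/-- Sets of edges of `Q_{m+1}` are equal if they have the same edges in the two faces of direction
`0` and the same edges of direction `0`. -/
theorem edges_ext {m : ℕ} {A B : Set (Sym2 (Finset (Fin (m + 1))))}
    (hA : A ⊆ (cube (m + 1)).edgeSet) (hB : B ⊆ (cube (m + 1)).edgeSet)
    (hface : ∀ b e, faceEdge b e ∈ A ↔ faceEdge b e ∈ B)
    (hcross : ∀ Y, crossEdge Y ∈ A ↔ crossEdge Y ∈ B) : A = B := by
  have key : ∀ e ∈ (cube (m + 1)).edgeSet, (e ∈ A ↔ e ∈ B) := by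
    intro e he
    rcases exists_faceEdge_or_crossEdge he with ⟨b, f, rfl⟩ | ⟨Y, rfl⟩
    · exact hface b f
    · exact hcross Y
  ext e
  exact ⟨fun h => (key e (hA h)).1 h, fun h => (key e (hB h)).2 h⟩

theorem glue_injective {m : ℕ} {X X' : Finset (Fin m)} {T T' : Bool → SpanningTree m}
    (h : glue X T = glue X' T') : X = X' ∧ T = T' := by
  constructor
  · have := crossEdge_mem_glue (X := X) (T := T) (Y := X)
    rw [h, crossEdge_mem_glue] at this
    exact this.2 rfl
  · funext b
    apply SpanningTree.ext_edges
    ext e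
    rw [← faceEdge_mem_glue (X := X), h, faceEdge_mem_glue]

/-! ### Cutting a spanning tree at its only cross edge -/

/-- If the only edge of direction `0` of a spanning tree of `Q_{m+1}` is the one above `X`, then
the restrictions of the tree to the two faces of direction `0` are trees. -/
theorem isTree_comap_face {m : ℕ} (T : SpanningTree (m + 1)) {X : Finset (Fin m)}
    (hX : ∀ Y, crossEdge Y ∈ T.edges ↔ Y = X) (b : Bool) : (T.1.comap (face b)).IsTree := by
  refine ⟨⟨fun Y Z => ?_⟩, T.2.2.isAcyclic.of_comap ⟨face b, face_injective b⟩⟩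
  -- Acyclicity is inherited along the injection `face b`. For connectedness, `g` retracts the cube
  -- onto face `b` by collapsing the whole opposite face to `X`, so walks of `T` project to walks
  -- inside the face.
  let g : Finset (Fin (m + 1)) → Finset (Fin m) :=
    fun W => if (0 ∈ W ↔ b = true) then lowerVertex W else X
  have hg : ∀ V W, T.1.Adj V W → (T.1.comap (face b)).Reachable (g V) (g W) := by
    intro V W h
    obtain ⟨c, V, rfl⟩ := exists_eq_face V
    obtain ⟨d, W, rfl⟩ := exists_eq_face W
    by_cases hcd : c = d
    · subst hcd
      by_cases hcb : c = b
      · subst hcb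
        have : (T.1.comap (face c)).Adj V W := h
        simpa [g] using this.reachable
      · have : ¬ (c = true ↔ b = true) := by cases b <;> cases c <;> simp_all
        simp [g, this]
    -- An edge between different faces can only be the bridge, and `g` sends both its ends to `X`.
    · have hmem : V = X ∧ W = X := by
        rcases exists_faceEdge_or_crossEdge 
            (T.edges_subset (show s(face c V, face d W) ∈ T.edges from h)) with
          ⟨a, f, hf⟩ | ⟨U, hU⟩
        · induction f with
          | _ P Q =>
            simp only [faceEdge, Sym2.map_mk, Sym2.eq_iff, face_inj] at hf
            exact absurd (by rcases hf with hf | hf <;> exact hf.1.1.trans hf.2.1.symm) hcd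
        · have hUX : U = X := (hX U).1 (hU ▸ h)
          simp only [crossEdge, Sym2.eq_iff, face_inj] at hU
          rcases hU with hU | hU
          · exact ⟨hU.1.2.trans hUX, hU.2.2.trans hUX⟩
          · exact ⟨hU.1.2.trans hUX, hU.2.2.trans hUX⟩
      have hgX : ∀ a, g (face a X) = X := fun a => by simp [g]
      rw [hmem.1, hmem.2, hgX, hgX]
  have hlift : ∀ V W, T.1.Walk V W → (T.1.comap (face b)).Reachable (g V) (g W) := by
    intro V W p
    induction p with
    | nil => rfl
    | cons h _ ih => exact (hg _ _ h).trans ih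
  obtain ⟨p⟩ := T.2.2.connected.preconnected (face b Y) (face b Z)
  simpa [g] using hlift _ _ p

theorem exists_eq_glue {m : ℕ} {T : SpanningTree (m + 1)} {X : Finset (Fin m)}
    (hX : ∀ Y, crossEdge Y ∈ T.edges ↔ Y = X) : ∃ U, T = glue X U := by
  refine ⟨fun b => ⟨T.1.comap (face b), fun Y Z h => cube_adj_face.1 (T.2.1 h),
    isTree_comap_face T hX b⟩, SpanningTree.ext_edges ?_⟩
  refine edges_ext T.edges_subset (SpanningTree.edges_subset _) (fun b e => ?_) fun Y => ?_
  · refine Iff.trans ?_ faceEdge_mem_glue.symm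
    induction e with
    | _ Y Z => rfl
  · exact (hX Y).trans crossEdge_mem_glue.symm

/-! ### Signatures of glued trees -/

theorem sig_zero {m : ℕ} (T : SpanningTree (m + 1)) :
    T.sig 0 = {Y | crossEdge Y ∈ T.edges}.ncard := by
  rw [← Set.ncard_image_of_injective _ (fun Y Z h => crossEdge_inj.1 h), SpanningTree.sig]
  congr 1
  ext e
  constructor
  · rintro ⟨he, hd⟩
    rcases exists_faceEdge_or_crossEdge (T.edges_subset he) with ⟨b, f, rfl⟩ | ⟨Y, rfl⟩
    · exact absurd hd not_hasDirection_zero_faceEdge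
    · exact ⟨Y, he, rfl⟩
  · rintro ⟨Y, hY, rfl⟩
    exact ⟨hY, hasDirection_crossEdge.2 rfl⟩

theorem sig_zero_eq_one_iff {m : ℕ} {T : SpanningTree (m + 1)} :
    T.sig 0 = 1 ↔ ∃ X U, T = glue X U := by
  rw [sig_zero, Set.ncard_eq_one]
  constructor
  · rintro ⟨X, hX⟩
    exact ⟨X, exists_eq_glue fun Y => by
      rw [← Set.mem_singleton_iff, ← hX, Set.mem_ofPred_eq]⟩
  · rintro ⟨X, U, rfl⟩
    exact ⟨X, by ext Y; simp [crossEdge_mem_glue]⟩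

theorem sig_glue_succ {m : ℕ} (X : Finset (Fin m)) (T : Bool → SpanningTree m) (i : Fin m) :
    (glue X T).sig i.succ = (T false).sig i + (T true).sig i := by
  simp only [SpanningTree.sig]
  rw [← Set.ncard_image_of_injective {e | e ∈ (T false).edges ∧ _} (faceEdge_injective false),
    ← Set.ncard_image_of_injective {e | e ∈ (T true).edges ∧ _} (faceEdge_injective true),
    ← Set.ncard_union_eq]
  · congr 1
    ext e
    constructor
    · rintro ⟨he, hd⟩
      rcases exists_faceEdge_or_crossEdge (SpanningTree.edges_subset _ he) with
        ⟨b, f, rfl⟩ | ⟨Y, rfl⟩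
      · rw [faceEdge_mem_glue] at he
        rw [hasDirection_faceEdge] at hd
        cases b
        · exact Or.inl ⟨f, ⟨he, hd⟩, rfl⟩
        · exact Or.inr ⟨f, ⟨he, hd⟩, rfl⟩
      · exact absurd (hasDirection_crossEdge.1 hd) (Fin.succ_ne_zero i)
    · rintro (⟨f, ⟨he, hd⟩, rfl⟩ | ⟨f, ⟨he, hd⟩, rfl⟩) <;>
        exact ⟨faceEdge_mem_glue.2 he, hasDirection_faceEdge.2 hd⟩
  · rw [Set.disjoint_left]
    rintro _ ⟨e, _, rfl⟩ ⟨f, _, h⟩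
    simp at h

theorem sig_glue {m : ℕ} (X : Finset (Fin m)) (T : Bool → SpanningTree m) :
    (glue X T).sig = Fin.cons 1 ((T false).sig + (T true).sig) := by
  funext i
  cases i using Fin.cases with
  | zero => exact sig_zero_eq_one_iff.2 ⟨X, T, rfl⟩
  | succ i => exact sig_glue_succ X T i

/-! ### Edge slides between glued trees -/

theorem cube_adj_iff_flipVertex {n : ℕ} {X Y : Finset (Fin n)} :
    (cube n).Adj X Y ↔ ∃ i, Y = flipVertex i X := by
  refine exists_congr fun i => ?_
  rw [flipVertex]
  constructor
  · rintro h
    rw [← h, symmDiff_symmDiff_cancel_left]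
  · rintro rfl
    rw [symmDiff_symmDiff_cancel_left]

theorem IsSlide.mem_edges_iff {n : ℕ} {i : Fin n} {e : Sym2 (Finset (Fin n))}
    {T T' : SpanningTree n} (h : IsSlide i e T T') (f : Sym2 (Finset (Fin n))) :
    f ∈ T'.edges ↔ f = flipEdge i e ∨ f ∈ T.edges ∧ f ≠ e := by
  rw [h.2.2.2, Set.mem_insert_iff, Set.mem_sdiff, Set.mem_singleton_iff]

theorem IsSlide.of_glue_faceEdge {m : ℕ} {X X' : Finset (Fin m)} {T T' : Bool → SpanningTree m}
    {i : Fin (m + 1)} {b : Bool} {e : Sym2 (Finset (Fin m))}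
    (h : IsSlide i (faceEdge b e) (glue X T) (glue X' T')) :
    X = X' ∧ (edgeSlideGraph m).Adj (T b) (T' b) ∧ T (!b) = T' (!b) := by
  have hmem := h.mem_edges_iff
  obtain ⟨⟨j, hj, hd⟩, he, hf, -⟩ := h
  cases i using Fin.cases with
  | zero =>
    rw [flipEdge_zero_faceEdge] at hmem hf
    -- A slide in direction `0` would add `e` to the tree of the opposite face and remove nothing
    -- from it. Nested spanning trees coincide, so `e` was already there, contrary to the definition
    -- of a slide.
    have hmem' : ∀ f, f ∈ (T' (!b)).edges ↔ f = e ∨ f ∈ (T (!b)).edges := fun f => by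
      simpa [faceEdge_mem_glue] using hmem (faceEdge (!b) f)
    have heq : T (!b) = T' (!b) :=
      SpanningTree.eq_of_subset fun f hf => (hmem' f).2 (Or.inr hf)
    rw [faceEdge_mem_glue, heq] at hf
    exact absurd ((hmem' e).2 (Or.inl rfl)) hf
  | succ i =>
    rw [flipEdge_succ_faceEdge] at hmem hf
    refine ⟨?_, ⟨i, e, ⟨?_, faceEdge_mem_glue.1 he, mt faceEdge_mem_glue.2 hf, ?_⟩⟩, ?_⟩
    · simpa [crossEdge_mem_glue] using hmem (crossEdge X)
    · cases j using Fin.cases with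
      | zero => exact absurd hd not_hasDirection_zero_faceEdge
      | succ j => exact ⟨j, fun hji => hj (congrArg Fin.succ hji), hasDirection_faceEdge.1 hd⟩
    · ext f
      simpa [faceEdge_mem_glue] using hmem (faceEdge b f)
    · apply SpanningTree.ext_edges
      ext f
      simpa [faceEdge_mem_glue] using (hmem (faceEdge (!b) f)).symm

theorem IsSlide.of_glue_crossEdge {m : ℕ} {X X' Y : Finset (Fin m)}
    {T T' : Bool → SpanningTree m} {i : Fin (m + 1)}
    (h : IsSlide i (crossEdge Y) (glue X T) (glue X' T')) : (cube m).Adj X X' ∧ T = T' := by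
  have hmem := h.mem_edges_iff
  obtain ⟨⟨j, hj, hd⟩, he, -, -⟩ := h
  obtain rfl : Y = X := crossEdge_mem_glue.1 he
  obtain rfl : j = 0 := hasDirection_crossEdge.1 hd
  -- The slid edge has direction `0`, so the direction of the slide is a nonzero one and the bridge
  -- moves to the flipped vertex.
  obtain ⟨i, rfl⟩ := Fin.exists_succ_eq.2 hj.symm
  rw [flipEdge_succ_crossEdge] at hmem
  constructor
  · rw [cube_adj_iff_flipVertex]
    refine ⟨i, ?_⟩
    simpa [crossEdge_mem_glue, eq_comm] using hmem (crossEdge (flipVertex i Y))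
  · funext b
    apply SpanningTree.ext_edges
    ext f
    simpa [faceEdge_mem_glue] using (hmem (faceEdge b f)).symm

theorem insert_sdiff_subset_cube {n : ℕ} {e f : Sym2 (Finset (Fin n))} {T : SpanningTree n}
    (hf : f ∈ (cube n).edgeSet) : insert f (T.edges \ {e}) ⊆ (cube n).edgeSet :=
  Set.insert_subset hf (Set.sdiff_subset.trans T.edges_subset)

theorem isSlide_glue_crossEdge {m : ℕ} (X : Finset (Fin m)) (T : Bool → SpanningTree m)
    (i : Fin m) : IsSlide i.succ (crossEdge X) (glue X T) (glue (flipVertex i X) T) := by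
  have hne : flipVertex i X ≠ X :=
    ((cube_adj_iff_flipVertex.2 ⟨i, rfl⟩ : (cube m).Adj X (flipVertex i X)).ne).symm
  refine ⟨⟨0, (Fin.succ_ne_zero i).symm, hasDirection_crossEdge.2 rfl⟩,
    crossEdge_mem_glue.2 rfl, ?_, ?_⟩
  · rwa [flipEdge_succ_crossEdge, crossEdge_mem_glue]
  · rw [flipEdge_succ_crossEdge]
    refine edges_ext (SpanningTree.edges_subset _)
      (insert_sdiff_subset_cube (cube_adj_face_not false _)) ?_ ?_
    · intro b e
      simp [faceEdge_mem_glue]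
    · intro Y
      simp only [crossEdge_mem_glue, Set.mem_insert_iff, Set.mem_sdiff, Set.mem_singleton_iff,
        crossEdge_inj]
      tauto

theorem IsSlide.glue {m : ℕ} {X : Finset (Fin m)} {T T' : Bool → SpanningTree m} {i : Fin m}
    {b : Bool} {e : Sym2 (Finset (Fin m))} (h : IsSlide i e (T b) (T' b))
    (hT : T (!b) = T' (!b)) : IsSlide i.succ (faceEdge b e) (glue X T) (glue X T') := by
  have hmem := h.mem_edges_iff
  obtain ⟨⟨j, hj, hd⟩, he, hf, -⟩ := h
  have hmem' : faceEdge b (flipEdge i e) ∈ (_root_.glue X T').edges :=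
    faceEdge_mem_glue.2 ((hmem _).2 (Or.inl rfl))
  refine ⟨⟨j.succ, fun hji => hj (Fin.succ_injective _ hji), hasDirection_faceEdge.2 hd⟩,
    faceEdge_mem_glue.2 he, ?_, ?_⟩
  · rwa [flipEdge_succ_faceEdge, faceEdge_mem_glue]
  · rw [flipEdge_succ_faceEdge]
    refine edges_ext (SpanningTree.edges_subset _)
      (insert_sdiff_subset_cube (SpanningTree.edges_subset _ hmem')) ?_ ?_
    · intro c f
      rw [faceEdge_mem_glue]
      by_cases hcb : c = b
      · subst hcb
        simpa [faceEdge_mem_glue] using hmem f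
      · obtain rfl : c = !b := Bool.eq_not.2 hcb
        simp [faceEdge_mem_glue, hT]
    · intro Y
      simp [crossEdge_mem_glue]

/-- The core of the argument: the slid edge is either the bridge, which moves `X` alone, or a face
edge, which alters one of the two trees alone. -/
theorem edgeSlideGraph_adj_glue {m : ℕ} {X X' : Finset (Fin m)} {T T' : Bool → SpanningTree m} :
    (edgeSlideGraph (m + 1)).Adj (glue X T) (glue X' T') ↔
      ((cube m).Adj X X' ∧ T = T') ∨
        (X = X' ∧ ∃ b, (edgeSlideGraph m).Adj (T b) (T' b) ∧ T (!b) = T' (!b)) := by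
  constructor
  · rintro ⟨i, e, h⟩
    rcases exists_faceEdge_or_crossEdge (SpanningTree.edges_subset _ h.2.1) with
      ⟨b, f, rfl⟩ | ⟨Y, rfl⟩
    · exact Or.inr ⟨h.of_glue_faceEdge.1, b, h.of_glue_faceEdge.2⟩
    · exact Or.inl h.of_glue_crossEdge
  · rintro (⟨hX, rfl⟩ | ⟨rfl, b, ⟨i, e, h⟩, hT⟩)
    · obtain ⟨i, rfl⟩ := cube_adj_iff_flipVertex.1 hX
      exact ⟨i.succ, _, isSlide_glue_crossEdge X T i⟩
    · exact ⟨i.succ, _, h.glue hT⟩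

/-! ### Invariance of the signature -/

theorem hasDirection_flipEdge_iff {n : ℕ} {e : Sym2 (Finset (Fin n))} {i j : Fin n} :
    HasDirection (flipEdge i e) j ↔ HasDirection e j :=
  ⟨fun h => flipEdge_flipEdge i e ▸ h.flipEdge i, fun h => h.flipEdge i⟩

/-- Edge slides preserve the signature. -/
theorem IsSlide.sig_eq {n : ℕ} {i : Fin n} {e : Sym2 (Finset (Fin n))} {T T' : SpanningTree n}
    (h : IsSlide i e T T') : T'.sig = T.sig := by
  funext j
  have hmem := h.mem_edges_iff
  obtain ⟨-, he, hf, -⟩ := h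
  simp only [SpanningTree.sig]
  by_cases hd : HasDirection e j
  -- Since `σ_i` preserves directions, the edges of direction `j` undergo a one-for-one exchange if
  -- `e` has direction `j`, and are unchanged otherwise.
  · rw [← Set.ncard_exchange (s := {e | e ∈ T.edges ∧ HasDirection e j})
      (a := flipEdge i e) (b := e) (fun h => hf h.1) ⟨he, hd⟩]
    congr 1
    ext f
    simp only [Set.mem_ofPred_eq, Set.mem_insert_iff, Set.mem_sdiff, Set.mem_singleton_iff, hmem]
    constructor
    · tauto
    · rintro (rfl | h)
      · exact ⟨Or.inl rfl, hd.flipEdge i⟩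
      · tauto
  · congr 1
    ext f
    simp only [Set.mem_ofPred_eq, hmem]
    constructor
    · rintro ⟨rfl | h, hfd⟩
      · exact absurd (hasDirection_flipEdge_iff.1 hfd) hd
      · exact ⟨h.1, hfd⟩
    · rintro ⟨hfT, hfd⟩
      exact ⟨Or.inr ⟨hfT, by rintro rfl; exact hd hfd⟩, hfd⟩

theorem sig_eq_of_adj {n : ℕ} {T T' : SpanningTree n} (h : (edgeSlideGraph n).Adj T T') :
    T.sig = T'.sig := by
  obtain ⟨i, e, h⟩ := h
  exact h.sig_eq.symm

/-! ### Triples and the box product -/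

/-- The spanning tree of `Q_{m+1}` given by a vertex and a pair of spanning trees of `Q_m`. -/
def gluePair {m : ℕ} (p : Finset (Fin m) × SpanningTree m × SpanningTree m) :
    SpanningTree (m + 1) :=
  glue p.1 fun b => bif b then p.2.2 else p.2.1

theorem gluePair_injective {m : ℕ} : Function.Injective (gluePair (m := m)) := by
  rintro ⟨X, T, U⟩ ⟨X', T', U'⟩ h
  obtain ⟨rfl, h⟩ := glue_injective h
  obtain rfl : T = T' := congrFun h false
  obtain rfl : U = U' := congrFun h true
  rfl

theorem exists_gluePair_eq {m : ℕ} {T : SpanningTree (m + 1)} (h : T.sig 0 = 1) :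
    ∃ p, gluePair p = T := by
  obtain ⟨X, U, rfl⟩ := sig_zero_eq_one_iff.1 h
  refine ⟨(X, U false, U true), congrArg (glue X) ?_⟩
  funext b
  cases b <;> rfl

theorem sig_gluePair {m : ℕ} (p : Finset (Fin m) × SpanningTree m × SpanningTree m) :
    (gluePair p).sig = Fin.cons 1 (p.2.1.sig + p.2.2.sig) :=
  sig_glue _ _

theorem edgeSlideGraph_adj_gluePair {m : ℕ}
    {p q : Finset (Fin m) × SpanningTree m × SpanningTree m} :
    (edgeSlideGraph (m + 1)).Adj (gluePair p) (gluePair q) ↔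
      ((cube m).boxProd ((edgeSlideGraph m).boxProd (edgeSlideGraph m))).Adj p q := by
  obtain ⟨X, T, U⟩ := p
  obtain ⟨X', T', U'⟩ := q
  have hfun : ((fun b => bif b then U else T) = fun b => bif b then U' else T') ↔
      T = T' ∧ U = U' := by
    simp [funext_iff, Bool.forall_bool]
  simp only [gluePair, edgeSlideGraph_adj_glue, SimpleGraph.boxProd_adj, hfun, Bool.exists_bool,
    Prod.mk.injEq, Bool.not_false, Bool.not_true, cond_false, cond_true]
  tauto

theorem edgeSlideSig_coe_adj {n : ℕ} {S : Fin n → ℕ} {T T' : (edgeSlideSig S).verts} :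
    (edgeSlideSig S).coe.Adj T T' ↔ (edgeSlideGraph n).Adj T.1 T'.1 :=
  ⟨fun h => (edgeSlideSig S).adj_sub h, fun h => ⟨T.2, T'.2, h⟩⟩

theorem mem_verts_edgeSlideSet {n : ℕ} {𝒳 : Set (Fin n → ℕ)} {T : SpanningTree n} :
    T ∈ (edgeSlideSet 𝒳).verts ↔ T.sig ∈ 𝒳 := by
  simp [edgeSlideSet, edgeSlideSig]

/-- A union of induced subgraphs need not be induced; here it is, because both ends of a slide have
the same signature and so lie in a common piece. -/
theorem edgeSlideSet_coe_adj {n : ℕ} {𝒳 : Set (Fin n → ℕ)} {T T' : (edgeSlideSet 𝒳).verts} :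
    (edgeSlideSet 𝒳).coe.Adj T T' ↔ (edgeSlideGraph n).Adj T.1 T'.1 := by
  refine ⟨fun h => (edgeSlideSet 𝒳).adj_sub h, fun h => ?_⟩
  have hT := mem_verts_edgeSlideSet.1 T.2
  exact SimpleGraph.Subgraph.iSup_adj.2 ⟨T.1.sig, SimpleGraph.Subgraph.iSup_adj.2
    ⟨hT, rfl, (sig_eq_of_adj h).symm, h⟩⟩

/-! ### Splitting by signature into disjoint unions -/

/-- A graph decomposed into pairwise non-adjacent pieces is isomorphic to their disjoint union. -/
theorem nonempty_iso_disjointUnion {ι V : Type*} {W : ι → Type*} (G : SimpleGraph V)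
    (H : ∀ i, SimpleGraph (W i)) (φ : ∀ i, W i → V)
    (hφ : Function.Bijective fun x : Σ i, W i => φ x.1 x.2)
    (hadj : ∀ i u v, G.Adj (φ i u) (φ i v) ↔ (H i).Adj u v)
    (hsep : ∀ i j u v, G.Adj (φ i u) (φ j v) → i = j) :
    Nonempty (G ≃g disjointUnion H) := by
  refine ⟨SimpleGraph.Iso.symm ⟨Equiv.ofBijective _ hφ, ?_⟩⟩
  rintro ⟨i, u⟩ ⟨j, v⟩
  change G.Adj (φ i u) (φ j v) ↔ _
  constructor
  · intro h
    obtain rfl := hsep i j u v h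
    exact ⟨i, u, v, (hadj i u v).1 h, rfl, rfl⟩
  · rintro ⟨k, a, b, h, hu, hv⟩
    cases hu
    cases hv
    exact (hadj _ _ _).2 h

/-- The inclusion of `Q_n □ E(S₁) □ E(S₂)` into `Q_n □ E(Q_n) □ E(Q_n)`. -/
def boxVal {n : ℕ} {S₁ S₂ : Fin n → ℕ}
    (x : Finset (Fin n) × (edgeSlideSig S₁).verts × (edgeSlideSig S₂).verts) :
    Finset (Fin n) × SpanningTree n × SpanningTree n :=
  (x.1, x.2.1.1, x.2.2.1)

theorem sig_boxVal_fst {n : ℕ} {S₁ S₂ : Fin n → ℕ}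
    (x : Finset (Fin n) × (edgeSlideSig S₁).verts × (edgeSlideSig S₂).verts) :
    (boxVal x).2.1.sig = S₁ :=
  x.2.1.2

theorem sig_boxVal_snd {n : ℕ} {S₁ S₂ : Fin n → ℕ}
    (x : Finset (Fin n) × (edgeSlideSig S₁).verts × (edgeSlideSig S₂).verts) :
    (boxVal x).2.2.sig = S₂ :=
  x.2.2.2

theorem boxVal_injective {n : ℕ} {S₁ S₂ : Fin n → ℕ} :
    Function.Injective (boxVal (S₁ := S₁) (S₂ := S₂)) := by
  rintro ⟨X, ⟨T, hT⟩, ⟨U, hU⟩⟩ ⟨X', ⟨T', hT'⟩, ⟨U', hU'⟩⟩ h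
  simp only [boxVal, Prod.mk.injEq] at h
  obtain ⟨rfl, rfl, rfl⟩ := h
  rfl

theorem boxProd_adj_boxVal {n : ℕ} {S₁ S₂ : Fin n → ℕ}
    (x y : Finset (Fin n) × (edgeSlideSig S₁).verts × (edgeSlideSig S₂).verts) :
    ((cube n).boxProd ((edgeSlideGraph n).boxProd (edgeSlideGraph n))).Adj
        (boxVal x) (boxVal y) ↔
      ((cube n).boxProd ((edgeSlideSig S₁).coe.boxProd (edgeSlideSig S₂).coe)).Adj x y := by
  simp only [SimpleGraph.boxProd_adj, edgeSlideSig_coe_adj, boxVal, Prod.ext_iff, Subtype.ext_iff]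

theorem sig_eq_of_boxProd_adj {n : ℕ} {p q : Finset (Fin n) × SpanningTree n × SpanningTree n}
    (h : ((cube n).boxProd ((edgeSlideGraph n).boxProd (edgeSlideGraph n))).Adj p q) :
    p.2.1.sig = q.2.1.sig ∧ p.2.2.sig = q.2.2.sig := by
  rw [SimpleGraph.boxProd_adj, SimpleGraph.boxProd_adj] at h
  rcases h with ⟨-, h⟩ | ⟨⟨h, h'⟩ | ⟨h, h'⟩, -⟩
  · rw [h]
    exact ⟨rfl, rfl⟩
  · exact ⟨sig_eq_of_adj h, by rw [h']⟩
  · exact ⟨by rw [h'], sig_eq_of_adj h⟩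

/-! ### The three isomorphisms -/

theorem nonempty_iso_edgeSlideSet_reducing {m : ℕ} (hm : 2 ≤ m + 1) :
    Nonempty ((edgeSlideSet (reducing ({0} : Finset (Fin (m + 1))))).coe ≃g
      (cube m).boxProd ((edgeSlideGraph m).boxProd (edgeSlideGraph m))) := by
  -- In dimension at least `2` a singleton is a proper subset, so reducing over it comes down to the
  -- equation `T.sig 0 = 1`.
  have huniv : ({0} : Finset (Fin (m + 1))) ≠ Finset.univ := by
    intro h
    have := congrArg Finset.card h
    simp at this
    omega
  have hverts : ∀ T : SpanningTree (m + 1),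
      T ∈ (edgeSlideSet (reducing ({0} : Finset (Fin (m + 1))))).verts ↔ T.sig 0 = 1 := by
    intro T
    have hsig : T.sig ∈ signatures (m + 1) := ⟨T, rfl⟩
    simp [mem_verts_edgeSlideSet, reducing, ReducesOver, huniv, hsig]
  let f : Finset (Fin m) × SpanningTree m × SpanningTree m →
      (edgeSlideSet (reducing ({0} : Finset (Fin (m + 1))))).verts :=
    fun p => ⟨gluePair p, (hverts _).2 (by rw [sig_gluePair]; rfl)⟩
  have hf : Function.Bijective f := by
    constructor
    · exact fun p q h => gluePair_injective (congrArg Subtype.val h)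
    · rintro ⟨T, hT⟩
      obtain ⟨p, rfl⟩ := exists_gluePair_eq ((hverts T).1 hT)
      exact ⟨p, rfl⟩
  refine ⟨SimpleGraph.Iso.symm ⟨Equiv.ofBijective f hf, ?_⟩⟩
  intro p q
  exact edgeSlideSet_coe_adj.trans edgeSlideGraph_adj_gluePair

theorem nonempty_iso_disjointUnion_boxProd (n : ℕ) :
    Nonempty ((cube n).boxProd ((edgeSlideGraph n).boxProd (edgeSlideGraph n)) ≃g
      disjointUnion (fun p : signatures n × signatures n =>
        (cube n).boxProd ((edgeSlideSig p.1.1).coe.boxProd (edgeSlideSig p.2.1).coe))) := by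
  refine nonempty_iso_disjointUnion _ _ (fun _ => boxVal) ⟨?_, ?_⟩
    (fun _ => boxProd_adj_boxVal) ?_
  · rintro ⟨i, x⟩ ⟨j, y⟩ h
    have h1 := congrArg (fun p => p.2.1.sig) h
    have h2 := congrArg (fun p => p.2.2.sig) h
    simp only [sig_boxVal_fst, sig_boxVal_snd] at h1 h2
    obtain rfl : i = j := Prod.ext (Subtype.ext h1) (Subtype.ext h2)
    exact Sigma.ext rfl (heq_of_eq (boxVal_injective h))
  · rintro ⟨X, T, U⟩
    -- Each triple lies in the piece indexed by the signatures of its own two trees.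
    exact ⟨⟨(⟨T.sig, T, rfl⟩, ⟨U.sig, U, rfl⟩), (X, ⟨T, rfl⟩, ⟨U, rfl⟩)⟩, rfl⟩
  · intro i j u v h
    have h := sig_eq_of_boxProd_adj h
    rw [sig_boxVal_fst, sig_boxVal_fst, sig_boxVal_snd, sig_boxVal_snd] at h
    exact Prod.ext (Subtype.ext h.1) (Subtype.ext h.2)

theorem nonempty_iso_edgeSlideSig_cons {m : ℕ} (S' : Fin m → ℕ) :
    Nonempty ((edgeSlideSig (Fin.cons 1 S' : Fin (m + 1) → ℕ)).coe ≃g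
      disjointUnion (fun p : {p : signatures m × signatures m // p.1.1 + p.2.1 = S'} =>
        (cube m).boxProd
          ((edgeSlideSig p.1.1.1).coe.boxProd (edgeSlideSig p.1.2.1).coe))) := by
  refine nonempty_iso_disjointUnion _ _
    (fun p x => ⟨gluePair (boxVal x), ?_⟩) ⟨?_, ?_⟩ ?_ ?_
  · change (gluePair (boxVal x)).sig = _
    rw [sig_gluePair, sig_boxVal_fst, sig_boxVal_snd, p.2]
  · rintro ⟨i, x⟩ ⟨j, y⟩ h
    have h : boxVal x = boxVal y := gluePair_injective (congrArg Subtype.val h)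
    have h1 := congrArg (fun p => p.2.1.sig) h
    have h2 := congrArg (fun p => p.2.2.sig) h
    simp only [sig_boxVal_fst, sig_boxVal_snd] at h1 h2
    obtain rfl : i = j := Subtype.ext (Prod.ext (Subtype.ext h1) (Subtype.ext h2))
    exact Sigma.ext rfl (heq_of_eq (boxVal_injective h))
  · rintro ⟨T, hT⟩
    replace hT : T.sig = Fin.cons 1 S' := hT
    obtain ⟨⟨X, U, W⟩, rfl⟩ := exists_gluePair_eq (T := T) (by rw [hT]; rfl)
    rw [sig_gluePair] at hT
    exact ⟨⟨⟨(⟨U.sig, U, rfl⟩, ⟨W.sig, W, rfl⟩), (Fin.cons_inj.1 hT).2⟩,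
      (X, ⟨U, rfl⟩, ⟨W, rfl⟩)⟩, rfl⟩
  · intro i u v
    exact (edgeSlideSig_coe_adj.trans edgeSlideGraph_adj_gluePair).trans (boxProd_adj_boxVal u v)
  · intro i j u v h
    have h := sig_eq_of_boxProd_adj
      (edgeSlideGraph_adj_gluePair.1 (edgeSlideSig_coe_adj.1 h))
    rw [sig_boxVal_fst, sig_boxVal_fst, sig_boxVal_snd, sig_boxVal_snd] at h
    exact Subtype.ext (Prod.ext (Subtype.ext h.1) (Subtype.ext h.2))

theorem theorem6p7 (m : ℕ) (hm : 2 ≤ m + 1) :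
    Nonempty ((edgeSlideSet (reducing ({0} : Finset (Fin (m + 1))))).coe ≃g
      (cube m).boxProd ((edgeSlideGraph m).boxProd (edgeSlideGraph m))) ∧
    Nonempty ((cube m).boxProd ((edgeSlideGraph m).boxProd (edgeSlideGraph m)) ≃g
      disjointUnion (fun p : signatures m × signatures m =>
        (cube m).boxProd
          ((edgeSlideSig p.1.1).coe.boxProd (edgeSlideSig p.2.1).coe))) ∧
    ∀ S' : Fin m → ℕ,
      (Fin.cons 1 S' : Fin (m + 1) → ℕ) ∈ reducing ({0} : Finset (Fin (m + 1))) →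
      Nonempty ((edgeSlideSig (Fin.cons 1 S' : Fin (m + 1) → ℕ)).coe ≃g
        disjointUnion (fun p : {p : signatures m × signatures m // p.1.1 + p.2.1 = S'} =>
          (cube m).boxProd
            ((edgeSlideSig p.1.1.1).coe.boxProd (edgeSlideSig p.1.2.1).coe))) :=
  ⟨nonempty_iso_edgeSlideSet_reducing hm, nonempty_iso_disjointUnion_boxProd m,
    fun S' _ => nonempty_iso_edgeSlideSig_cons S'⟩
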